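/- Let $n\ge 2$ and let $Q_n=\langle x,y : x^{2n}=1,\ x^n=y^2,\ y^{-1}xy=x^{-1}\rangle$ be the dicyclic group of order $4n$. Its generating graph $\Gamma(Q_n)$ has vertex set $Q_n$, two distinct elements being adjacent exactly when together they generate $Q_n$. Let $\Delta(Q_n)$ be the graph obtained from $\Gamma(Q_n)$ by removing its isolated vertices, i.e. the subgraph induced on the set of vertices having at least one neighbour. Let $n_0$ be the product of the distinct primes dividing $n$, let $\varphi$ be Euler's totient function and $\mu$ the Möbius function. Then $\Delta(Q_n)$ is connected, and the spectrum of its distance matrix (the real matrix indexed by the vertices whose $(u,v)$ entry is the length of a shortest path from $u$ to $v$), as a multiset in which every eigenvalue is repeated according to its multiplicity, is the sum (union with multiplicities added) of: - $-2$ with multiplicity $2(\varphi(n)+n)-n_0-1$; - for every divisor $d>1$ of $n_0$, the number $-2-2\mu(d)\dfrac{\varphi(n)}{\varphi(d)}$ with multiplicity $\varphi(d)$; - each of the two numbers $\bigl(\varphi(n)+2(n-1)\bigr)\pm\sqrt{(3\varphi(n)-2n)^2+4n\varphi(n)}$ with multiplicity $1$. (Numbers listed in different items, or for different $d$, may coincide;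 their multiplicities are then added.) -/

import Mathlib

/-- The generating graph of a group `G`: the vertices are the elements of `G`, and two distinct
elements are adjacent when together they generate `G`. -/
def generatingGraph (G : Type*) [Group G] : SimpleGraph G where
  Adj g h := g ≠ h ∧ Subgroup.closure {g, h} = ⊤
  symm := ⟨fun g h hgh => ⟨hgh.1.symm, by rw [Set.pair_comm]; exact hgh.2⟩⟩
  loopless := ⟨fun _ h => h.1 rfl⟩

/-- The graph obtained from the generating graph of `G` by removing its isolated vertices, i.e. the
subgraph induced on the set of vertices that have at least one neighbour. -/
def reducedGeneratingGraph (G : Type*) [Group G] :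
    SimpleGraph (generatingGraph G).support :=
  (generatingGraph G).induce (generatingGraph G).support

/-- The distance matrix of a (connected) graph: the entry at `(u, v)` is the length of a shortest
path from `u` to `v`. -/
noncomputable def distanceMatrix {V : Type*} (X : SimpleGraph V) : Matrix V V ℝ :=
  Matrix.of fun u v => (X.dist u v : ℝ)

open Classical in
/-- The distance spectrum of a finite connected graph: the multiset of eigenvalues of its (real
symmetric) distance matrix, each repeated according to its multiplicity as a root of the
characteristic polynomial. -/
noncomputable def distanceSpectrum {V : Type*} [Finite V] (X : SimpleGraph V) : Multiset ℝ :=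
  letI : Fintype V := Fintype.ofFinite V
  (distanceMatrix X).charpoly.roots

/-! The non-isolated vertices are the `2φ(n)` elements `a i` with `i` coprime to `n` and all `2n`
elements `xa i`. Two `a`'s never generate, such an `a i` generates with every `xa j`, and `xa i`,
`xa j` generate exactly when `j - i` is coprime to `n`. All distances are therefore at most 2, and
the distance matrix has diagonal blocks `2J - 2I` and `2J - 2I - W`, with `W` circulant, and
off-diagonal blocks `J`.

A Fourier transform on each block diagonalises `W` and concentrates every `J` at the trivial
characters. These give a 2×2 block, the source of the two square-root eigenvalues; every other
character gives `-2` or `-2 - λ`, with `λ` an eigenvalue of `W`.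

For a character of order `d`, `λ` is a Ramanujan-type sum: `2μ(d)φ(n)/φ(d)` if `d ∣ n`, else `0`. It
vanishes unless `d` divides the radical of `n`, and `φ(d)` characters have order `d`. -/

/-! ### Ramanujan sums -/

theorem sum_primitiveRoots_eq_moebius {e : ℕ} (he : 0 < e) :
    ∑ z ∈ primitiveRoots e ℂ, z = (ArithmeticFunction.moebius e : ℂ) := by
  have key : ∀ n > 0, ∑ i ∈ n.divisors, ∑ z ∈ primitiveRoots i ℂ, z =
      if n = 1 then (1 : ℂ) else 0 := by
    intro n hn
    classical
    rw [← Finset.sum_biUnion, ← IsPrimitiveRoot.nthRoots_one_eq_biUnion_primitiveRoots]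
    · obtain rfl | h1 : n = 1 ∨ 1 < n := by lia
      · simp [IsPrimitiveRoot.nthRoots_one_eq_biUnion_primitiveRoots]
      · have hζ := Complex.isPrimitiveRoot_exp n hn.ne'
        rw [Finset.sum_eq_multiset_sum, Polynomial.nthRootsFinset,
          Multiset.toFinset_val, hζ.nthRoots_one_nodup.dedup, hζ.nthRoots_eq (one_pow n)]
        simp only [mul_one, Multiset.map_map, Function.comp_def, if_neg h1.ne']
        exact hζ.geom_sum_eq_zero h1
    · intro i _ j _ hij
      exact IsPrimitiveRoot.disjoint hij
  -- Möbius inversion of `key`: only the pair `(e, 1)` survives.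
  have := ArithmeticFunction.sum_eq_iff_sum_mul_moebius_eq.1 key e he
  rw [← this, Finset.sum_eq_single (e, 1)]
  · simp
  · rintro ⟨x, y⟩ h h'
    have := (Nat.mem_divisorsAntidiagonal.1 h).1
    have : y ≠ 1 := by rintro rfl; simp_all
    simp [this]
  · simp [he.ne']

theorem sum_units_pow_eq_moebius {e : ℕ} [NeZero e] {ω : ℂ} (hω : IsPrimitiveRoot ω e) :
    ∑ u : (ZMod e)ˣ, ω ^ (u : ZMod e).val = (ArithmeticFunction.moebius e : ℂ) := by
  have he : 0 < e := NeZero.pos e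
  rw [← sum_primitiveRoots_eq_moebius he]
  refine Finset.sum_bij (fun u _ => ω ^ (u : ZMod e).val) ?_ ?_ ?_ ?_
  · intro u _
    exact (mem_primitiveRoots he).2 (hω.pow_of_coprime _ (ZMod.val_coe_unit_coprime u))
  · intro u _ v _ h
    exact Units.ext (ZMod.val_injective e (hω.pow_inj (ZMod.val_lt _) (ZMod.val_lt _) h))
  · intro z hz
    obtain ⟨i, hi, hc, rfl⟩ := hω.isPrimitiveRoot_iff.1 ((mem_primitiveRoots he).1 hz)
    exact ⟨ZMod.unitOfCoprime i hc, Finset.mem_univ _, by simp [ZMod.val_natCast, Nat.mod_eq_of_lt hi]⟩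
  · intro _ _
    rfl

/-- `ω ^ u` depends only on `u` modulo `e`, and reduction of units from `n` to `e` is surjective
with fibres of equal size `φ(n)/φ(e)`. -/
theorem sum_units_pow_of_dvd {e n : ℕ} [NeZero n] (hen : e ∣ n) {ω : ℂ}
    (hω : IsPrimitiveRoot ω e) :
    ∑ u : (ZMod n)ˣ, ω ^ (u : ZMod n).val =
      ArithmeticFunction.moebius e * ((n.totient : ℂ) / e.totient) := by
  classical
  have he : NeZero e := ⟨fun h => NeZero.ne n (Nat.eq_zero_of_zero_dvd (h ▸ hen))⟩
  have hsurj := ZMod.unitsMap_surjective hen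
  set f := ZMod.unitsMap hen
  have hval : ∀ u : (ZMod n)ˣ, ω ^ (u : ZMod n).val = ω ^ (f u : ZMod e).val := by
    intro u
    have : (f u : ZMod e) = ((u : ZMod n).val : ZMod e) := by
      simp [f, ZMod.unitsMap_def]
    rw [this, ZMod.val_natCast, hω.eq_orderOf, pow_mod_orderOf]
  have hfib : ∀ v : (ZMod e)ˣ, (Finset.univ.filter fun u => f u = v).card =
      (Finset.univ.filter fun u => f u = 1).card := fun v =>
    MonoidHom.card_fiber_eq_of_mem_range f (hsurj v) (hsurj 1)
  set c := (Finset.univ.filter fun u => f u = 1).card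
  have hcard : n.totient = e.totient * c := by
    rw [← ZMod.card_units_eq_totient n, ← ZMod.card_units_eq_totient e, ← Finset.card_univ,
      Finset.card_eq_sum_card_fiberwise (f := f) (t := Finset.univ) (by simp [Set.MapsTo])]
    simp [hfib]
  have hφ : (e.totient : ℂ) ≠ 0 := by
    exact_mod_cast (Nat.totient_pos.2 (NeZero.pos e)).ne'
  simp_rw [hval]
  rw [← Finset.sum_fiberwise Finset.univ f, hcard, Nat.cast_mul, mul_div_cancel_left₀ _ hφ,
    ← sum_units_pow_eq_moebius hω, Finset.sum_mul]
  refine Finset.sum_congr rfl fun v _ => ?_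
  rw [Finset.sum_congr rfl (g := fun _ => ω ^ (v : ZMod e).val)
    (by intro u hu; rw [(Finset.mem_filter.1 hu).2]), Finset.sum_const, hfib, nsmul_eq_mul, mul_comm]

theorem sum_coprime_pow_of_dvd {e n : ℕ} [NeZero n] (hen : e ∣ n) {ω : ℂ}
    (hω : IsPrimitiveRoot ω e) :
    ∑ j ∈ Finset.range n with j.Coprime n, ω ^ j =
      ArithmeticFunction.moebius e * ((n.totient : ℂ) / e.totient) := by
  rw [← sum_units_pow_of_dvd hen hω]
  symm
  refine Finset.sum_bij (fun u _ => (u : ZMod n).val) ?_ ?_ ?_ ?_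
  · intro u _
    exact Finset.mem_filter.2 ⟨Finset.mem_range.2 (ZMod.val_lt _), ZMod.val_coe_unit_coprime u⟩
  · intro u _ v _ h
    exact Units.ext (ZMod.val_injective n h)
  · intro i hi
    simp only [Finset.mem_filter, Finset.mem_range] at hi
    exact ⟨ZMod.unitOfCoprime i hi.2, Finset.mem_univ _,
      by simp [ZMod.val_natCast, Nat.mod_eq_of_lt hi.1]⟩
  · intro _ _
    rfl

theorem sum_coprime_pow_range_two_mul {n : ℕ} (ω : ℂ) :
    ∑ j ∈ Finset.range (2 * n) with j.Coprime n, ω ^ j =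
      (1 + ω ^ n) * ∑ j ∈ Finset.range n with j.Coprime n, ω ^ j := by
  simp only [Finset.sum_filter]
  rw [two_mul, Finset.sum_range_add, add_mul, one_mul, Finset.mul_sum]
  congr 1
  refine Finset.sum_congr rfl fun j _ => ?_
  simp [pow_add]

/-- The real number `∑ ω ^ j`, where `ω` has order `e ∣ 2 * n` and `j < 2 * n` is coprime
to `n`. -/
noncomputable def coprimeSumValue (n e : ℕ) : ℝ :=
  if e ∣ n then 2 * ArithmeticFunction.moebius e * ((n.totient : ℝ) / e.totient) else 0

theorem sum_coprime_pow_eq_coprimeSumValue {e n : ℕ} [NeZero n] (hen : e ∣ 2 * n) {ω : ℂ}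
    (hω : IsPrimitiveRoot ω e) :
    ∑ j ∈ Finset.range (2 * n) with j.Coprime n, ω ^ j = (coprimeSumValue n e : ℂ) := by
  rw [sum_coprime_pow_range_two_mul, coprimeSumValue]
  split_ifs with h
  · rw [sum_coprime_pow_of_dvd h hω, (hω.pow_eq_one_iff_dvd n).2 h]
    push_cast
    ring
  · have h1 : ω ^ n ≠ 1 := fun h' => h (hω.dvd_of_pow_eq_one n h')
    have h2 : (ω ^ n) ^ 2 = 1 := by
      rw [← pow_mul, mul_comm]
      exact (hω.pow_eq_one_iff_dvd _).2 hen
    -- If `e ∤ n`, the sums over the two halves of `range (2 * n)` cancel.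
    have h3 : ω ^ n = -1 := (by simpa using sq_eq_sq_iff_eq_or_eq_neg.1 (h2.trans (one_pow 2).symm) : ω ^ n = 1 ∨ ω ^ n = -1).resolve_left h1
    simp [h3]

theorem coprimeSumValue_of_not_dvd_radical {n e : ℕ} (hn : n ≠ 0)
    (h : ¬ e ∣ UniqueFactorizationMonoid.radical n) : coprimeSumValue n e = 0 := by
  rw [coprimeSumValue]
  split_ifs with hen
  · have : ¬ Squarefree e := fun hs =>
      h ((UniqueFactorizationMonoid.dvd_radical_iff hs.isRadical hn).2 hen)
    simp [ArithmeticFunction.moebius_eq_zero_of_not_squarefree this]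
  · rfl

/-! ### Characteristic polynomials via the discrete Fourier transform -/

open Polynomial

theorem Matrix.det_eq_of_offDiag_pair {ι R : Type*} [Fintype ι] [DecidableEq ι] [CommRing R]
    (M : Matrix ι ι R) {a b : ι} (hab : a ≠ b)
    (h : ∀ i j, i ≠ j → ¬ (i = a ∧ j = b) → ¬ (i = b ∧ j = a) → M i j = 0) :
    M.det = (M a a * M b b - M a b * M b a) * ∏ i ∈ (Finset.univ.erase a).erase b, M i i := by
  rw [Matrix.twoBlockTriangular_det M (fun i => i = a ∨ i = b)
    (fun i hi j hj => h i j (by grind) (by grind) (by grind))]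
  congr 1
  · let f : Fin 2 → {i // i = a ∨ i = b} := ![⟨a, .inl rfl⟩, ⟨b, .inr rfl⟩]
    have hf : Function.Bijective f := by
      constructor
      · intro i j hij
        fin_cases i <;> fin_cases j <;> simp_all [f, hab.symm]
      · rintro ⟨i, rfl | rfl⟩
        · exact ⟨0, rfl⟩
        · exact ⟨1, rfl⟩
    rw [← Matrix.det_submatrix_equiv_self (Equiv.ofBijective f hf), Matrix.det_fin_two]
    simp [f, Matrix.toSquareBlockProp]
  · have : M.toSquareBlockProp (fun i => ¬ (i = a ∨ i = b)) =
        Matrix.diagonal fun i => M i.1 i.1 := by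
      ext ⟨i, hi⟩ ⟨j, hj⟩
      by_cases hij : i = j
      · subst hij
        simp [Matrix.toSquareBlockProp]
      · simp only [Matrix.toSquareBlockProp]
        rw [Matrix.diagonal_apply_ne _ (by simpa using hij)]
        exact h i j hij (by grind) (by grind)
    rw [this, Matrix.det_diagonal]
    symm
    exact Finset.prod_subtype _ (by grind) _

theorem Matrix.charpoly_eq_of_offDiag_pair {ι R : Type*} [Fintype ι] [DecidableEq ι] [CommRing R]
    (M : Matrix ι ι R) {a b : ι} (hab : a ≠ b)
    (h : ∀ i j, i ≠ j → ¬ (i = a ∧ j = b) → ¬ (i = b ∧ j = a) → M i j = 0) :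
    M.charpoly = ((X - C (M a a)) * (X - C (M b b)) - C (M a b) * C (M b a)) *
      ∏ i ∈ (Finset.univ.erase a).erase b, (X - C (M i i)) := by
  rw [Matrix.charpoly, Matrix.det_eq_of_offDiag_pair _ hab]
  · simp [Matrix.charmatrix_apply_ne _ _ _ hab, Matrix.charmatrix_apply_ne _ _ _ hab.symm]
  · intro i j hij h1 h2
    simp [Matrix.charmatrix_apply_ne _ _ _ hij, h i j hij h1 h2]

theorem Matrix.charpoly_eq_of_mul_eq_mul {ι R : Type*} [Fintype ι] [DecidableEq ι] [CommRing R]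
    {M K P : Matrix ι ι R} (hP : IsUnit P) (h : M * P = P * K) : M.charpoly = K.charpoly := by
  obtain ⟨u, rfl⟩ := hP
  rw [← Matrix.charpoly_units_conj u K, ← h, mul_assoc]
  simp

/-- The character table of `ZMod N`. -/
noncomputable def dftMatrix (N : ℕ) [NeZero N] : Matrix (ZMod N) (ZMod N) ℂ :=
  Matrix.of fun i j => ZMod.stdAddChar (i * j)

theorem isUnit_dftMatrix (N : ℕ) [NeZero N] : IsUnit (dftMatrix N) := by
  have h : dftMatrix N * Matrix.of (fun i j => (N : ℂ)⁻¹ * ZMod.stdAddChar (-(i * j))) = 1 := by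
    ext i k
    have : ∀ j : ZMod N, ZMod.stdAddChar (i * j) * ((N : ℂ)⁻¹ * ZMod.stdAddChar (-(j * k))) =
        (N : ℂ)⁻¹ * ZMod.stdAddChar (j * (i - k)) := by
      intro j
      rw [mul_left_comm, ← AddChar.map_add_eq_mul]
      ring_nf
    simp only [dftMatrix, Matrix.mul_apply, Matrix.of_apply, this]
    rw [← Finset.mul_sum, AddChar.sum_mulShift _ (ZMod.isPrimitive_stdAddChar N)]
    simp [Matrix.one_apply, sub_eq_zero, ZMod.card]
  exact (Matrix.isUnit_iff_isUnit_det _).2 (Matrix.isUnit_det_of_right_inverse h)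

theorem ones_mul_dftMatrix {ι : Type*} (N : ℕ) [NeZero N] :
    (Matrix.of fun _ _ => 1 : Matrix ι (ZMod N) ℂ) * dftMatrix N =
      Matrix.of fun _ k => if k = 0 then (N : ℂ) else 0 := by
  ext i k
  simp only [dftMatrix, Matrix.mul_apply, Matrix.of_apply, one_mul]
  rw [AddChar.sum_mulShift _ (ZMod.isPrimitive_stdAddChar N)]
  simp [ZMod.card]

theorem dftMatrix_mul_single {ι : Type*} [DecidableEq ι] (N : ℕ) [NeZero N] (b : ι) (c : ℂ) :
    dftMatrix N * (Matrix.of fun i k => if i = 0 ∧ k = b then c else 0 : Matrix (ZMod N) ι ℂ) =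
      Matrix.of fun _ k => if k = b then c else 0 := by
  ext i k
  simp [dftMatrix, Matrix.mul_apply, ite_and]

/-- Characters are eigenvectors of a circulant matrix, with the Fourier coefficients of `w` as
eigenvalues. -/
theorem circulant_mul_dftMatrix {N : ℕ} [NeZero N] (w : ZMod N → ℂ) :
    (Matrix.of fun i j => w (j - i)) * dftMatrix N =
      dftMatrix N * Matrix.diagonal fun k => ∑ t, w t * ZMod.stdAddChar (t * k) := by
  ext i k
  rw [Matrix.mul_diagonal, Matrix.mul_apply]
  simp only [dftMatrix, Matrix.of_apply]
  rw [Finset.mul_sum, ← Equiv.sum_comp (Equiv.addRight i)]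
  refine Finset.sum_congr rfl fun t _ => ?_
  simp only [Equiv.coe_addRight, add_sub_cancel_right, add_mul, AddChar.map_add_eq_mul]
  ring

/-- This is the shape left by the Fourier transform: `a` and `b` index the trivial characters, the
only ones coupled. -/
theorem charpoly_twoBlock_single {ι κ : Type*} [Fintype ι] [DecidableEq ι] [Fintype κ]
    [DecidableEq κ] (a : ι) (b : κ) (p q r s : ℂ) (l : κ → ℂ) :
    (Matrix.fromBlocks
      ((Matrix.of fun i k => if i = a ∧ k = a then p else 0) - (2 : ℂ) • (1 : Matrix ι ι ℂ))
      (Matrix.of fun i k => if i = a ∧ k = b then q else 0)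
      (Matrix.of fun i k => if i = b ∧ k = a then r else 0)
      ((Matrix.of fun i k => if i = b ∧ k = b then s else 0) - (2 : ℂ) • (1 : Matrix κ κ ℂ)
        - Matrix.diagonal l)).charpoly =
    ((X - C (p - 2)) * (X - C (s - 2 - l b)) - C q * C r) *
      ((X - C (-2)) ^ (Fintype.card ι - 1) * ∏ k ∈ Finset.univ.erase b, (X - C (-2 - l k))) := by
  rw [Matrix.charpoly_eq_of_offDiag_pair _ (a := Sum.inl a) (b := Sum.inr b) (by simp)]
  · congr 1
    · simp
    · have : ((Finset.univ.erase (Sum.inl a)).erase (Sum.inr b) : Finset (ι ⊕ κ)) =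
          (Finset.univ.erase a).disjSum (Finset.univ.erase b) := by
        ext (x | x) <;> simp
      rw [this, Finset.prod_disjSum]
      congr 1
      · rw [Finset.prod_congr rfl (g := fun _ => X - C (-2))]
        · simp
        · intro i hi
          simp [Finset.ne_of_mem_erase hi]
      · refine Finset.prod_congr rfl fun i hi => ?_
        simp [Finset.ne_of_mem_erase hi]
  · rintro (i | i) (j | j) hij h1 h2
    · have h : i ≠ j := fun h => hij (h ▸ rfl)
      simp [Matrix.one_apply_ne h]
      grind
    · simp only [Matrix.fromBlocks_apply₁₂, Matrix.of_apply]
      grind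
    · simp only [Matrix.fromBlocks_apply₂₁, Matrix.of_apply]
      grind
    · have h : i ≠ j := fun h => hij (h ▸ rfl)
      simp [Matrix.one_apply_ne h, Matrix.diagonal_apply_ne _ h]
      grind

/-- The characteristic polynomial of a two-block matrix whose diagonal blocks are `2J - 2I` and
`2J - 2I - circulant w`, and whose off-diagonal blocks have all entries equal to `1`. -/
theorem charpoly_twoBlock {m N : ℕ} [NeZero m] [NeZero N] (w : ZMod N → ℂ) (l : ZMod N → ℂ)
    (hl : ∀ k, ∑ t, w t * ZMod.stdAddChar (t * k) = l k) :
    (Matrix.fromBlocks (Matrix.of fun i j : ZMod m => if i = j then (0 : ℂ) else 2)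
      (Matrix.of fun _ _ => 1) (Matrix.of fun _ _ => 1)
      (Matrix.of fun i j : ZMod N => (if i = j then 0 else 2) - w (j - i))).charpoly =
    ((X - C (2 * m - 2 : ℂ)) * (X - C (2 * N - 2 - l 0)) - C (N : ℂ) * C (m : ℂ)) *
      ((X - C (-2)) ^ (m - 1) * ∏ k ∈ Finset.univ.erase 0, (X - C (-2 - l k))) := by
  have hK := charpoly_twoBlock_single (0 : ZMod m) (0 : ZMod N) (2 * m) N m (2 * N) l
  rw [ZMod.card] at hK
  rw [← hK]
  refine Matrix.charpoly_eq_of_mul_eq_mul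
    (P := Matrix.fromBlocks (dftMatrix m) 0 0 (dftMatrix N)) ?_ ?_
  · rw [Matrix.isUnit_iff_isUnit_det, Matrix.det_fromBlocks_zero₂₁]
    exact ((Matrix.isUnit_iff_isUnit_det _).1 (isUnit_dftMatrix m)).mul
      ((Matrix.isUnit_iff_isUnit_det _).1 (isUnit_dftMatrix N))
  · have hA : ∀ M : ℕ, (Matrix.of fun i j : ZMod M => if i = j then (0 : ℂ) else 2) =
        (2 : ℂ) • (Matrix.of fun _ _ => 1) - (2 : ℂ) • 1 := by
      intro M
      ext i j
      by_cases h : i = j <;> simp [h]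
    have hB : (Matrix.of fun i j : ZMod N => (if i = j then (0 : ℂ) else 2) - w (j - i)) =
        (Matrix.of fun i j : ZMod N => if i = j then (0 : ℂ) else 2) -
          Matrix.of fun i j : ZMod N => w (j - i) := rfl
    rw [Matrix.fromBlocks_multiply, Matrix.fromBlocks_multiply, hB, hA, hA]
    simp only [Matrix.mul_zero, Matrix.zero_mul, add_zero, zero_add, Matrix.sub_mul,
      Matrix.mul_sub, Matrix.smul_mul, Matrix.mul_smul, Matrix.one_mul, Matrix.mul_one,
      ones_mul_dftMatrix, dftMatrix_mul_single, circulant_mul_dftMatrix, hl]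
    congr 1 <;> ext i k <;> simp

/-! ### Generating pairs of the dicyclic group -/

namespace QuaternionGroup

variable {n : ℕ}

/-- The subgroup of `QuaternionGroup n` consisting of the `a i` with `g ∣ i` and the `xa i` with
`i ≡ j` modulo `g`, where `g` divides `n`. -/
def congruenceSubgroup {g : ℕ} (hg : g ∣ n) (j : ZMod (2 * n)) :
    Subgroup (QuaternionGroup n) where
  carrier := {x | match x with
    | a i => ZMod.castHom (hg.mul_left 2) (ZMod g) i = 0
    | xa i => ZMod.castHom (hg.mul_left 2) (ZMod g) i = ZMod.castHom (hg.mul_left 2) (ZMod g) j}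
  one_mem' := map_zero (ZMod.castHom (hg.mul_left 2) (ZMod g))
  mul_mem' := by
    -- Products of two `xa`'s carry a shift by `n`, which vanishes modulo `g`.
    have hn : (n : ZMod g) = 0 := (ZMod.natCast_eq_zero_iff n g).2 hg
    rintro (i | i) (k | k) hi hk <;>
      simp_all [-ZMod.castHom_apply]
  inv_mem' := by
    have hn : (n : ZMod g) = 0 := (ZMod.natCast_eq_zero_iff n g).2 hg
    rintro (i | i) hi
    · change ZMod.castHom (hg.mul_left 2) (ZMod g) (-i) = 0
      simp_all [-ZMod.castHom_apply]
    · change ZMod.castHom (hg.mul_left 2) (ZMod g) (n + i) = _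
      simp_all [-ZMod.castHom_apply]

theorem congruenceSubgroup_ne_top {g : ℕ} (hg : g ∣ n) (hg1 : g ≠ 1) (j : ZMod (2 * n)) :
    congruenceSubgroup hg j ≠ ⊤ := by
  intro h
  have h1 : (a 1 : QuaternionGroup n) ∈ congruenceSubgroup hg j := h ▸ Subgroup.mem_top _
  change ZMod.castHom (hg.mul_left 2) (ZMod g) 1 = 0 at h1
  rw [map_one] at h1
  have := (ZMod.natCast_eq_zero_iff 1 g).1 (by simpa using h1)
  exact hg1 (Nat.dvd_one.1 this)

theorem castHom_gcd_val_eq_zero [NeZero n] (i : ZMod (2 * n)) :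
    ZMod.castHom ((Nat.gcd_dvd_right i.val n).mul_left 2) (ZMod (i.val.gcd n)) i = 0 := by
  conv_lhs => enter [2]; rw [← ZMod.natCast_zmod_val i]
  rw [map_natCast, ZMod.natCast_eq_zero_iff]
  exact Nat.gcd_dvd_left _ _

/-- The exponents `t` with `a t ∈ H` form an additive group containing `i` and, since `xa j` squares
to `a n`, also `n`; by Bézout it contains 1. -/
theorem eq_top_of_mem [NeZero n] {H : Subgroup (QuaternionGroup n)} {i j : ZMod (2 * n)}
    (hi : a i ∈ H) (hj : xa j ∈ H) (h : i.val.Coprime n) : H = ⊤ := by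
  let A : AddSubgroup (ZMod (2 * n)) :=
    { carrier := {t | a t ∈ H}
      zero_mem' := H.one_mem
      add_mem' := fun {s t} hs ht => by simpa using H.mul_mem hs ht
      neg_mem' := fun {s} hs => H.inv_mem hs }
  have hiA : i ∈ A := hi
  have hnA : (n : ZMod (2 * n)) ∈ A := by
    change a _ ∈ H
    rw [← xa_sq j]
    exact H.pow_mem hj 2
  have h1 : (1 : ZMod (2 * n)) ∈ A := by
    have hb := Nat.gcd_eq_gcd_ab i.val n
    rw [h.gcd_eq_one] at hb
    have hb' := congrArg (Int.cast : ℤ → ZMod (2 * n)) hb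
    push_cast at hb'
    rw [ZMod.natCast_zmod_val] at hb'
    rw [hb']
    refine A.add_mem ?_ ?_
    · simpa [mul_comm] using A.zsmul_mem hiA (i.val.gcdA n)
    · simpa [mul_comm] using A.zsmul_mem hnA (i.val.gcdB n)
  have hall : ∀ t, a t ∈ H := by
    intro t
    have : t.val • (1 : ZMod (2 * n)) ∈ A := A.nsmul_mem h1 _
    rw [nsmul_one, ZMod.natCast_zmod_val] at this
    exact this
  rw [Subgroup.eq_top_iff']
  rintro (t | t)
  · exact hall t
  · simpa using H.mul_mem hj (hall (t - j))

theorem closure_a_xa [NeZero n] (i j : ZMod (2 * n)) :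
    Subgroup.closure {a i, xa j} = (⊤ : Subgroup (QuaternionGroup n)) ↔ i.val.Coprime n := by
  constructor
  · intro h
    by_contra hc
    refine congruenceSubgroup_ne_top (Nat.gcd_dvd_right i.val n) hc j (top_le_iff.1 ?_)
    rw [← h, Subgroup.closure_le]
    rintro x (rfl | rfl)
    · exact castHom_gcd_val_eq_zero i
    · rfl
  · exact eq_top_of_mem (i := i) (j := j) (Subgroup.subset_closure (by simp))
      (Subgroup.subset_closure (by simp))

theorem closure_xa_xa [NeZero n] (i j : ZMod (2 * n)) :
    Subgroup.closure {xa i, xa j} = (⊤ : Subgroup (QuaternionGroup n)) ↔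
      (j - i).val.Coprime n := by
  constructor
  · intro h
    by_contra hc
    refine congruenceSubgroup_ne_top (Nat.gcd_dvd_right (j - i).val n) hc i (top_le_iff.1 ?_)
    rw [← h, Subgroup.closure_le]
    rintro x (rfl | rfl)
    · rfl
    · have := castHom_gcd_val_eq_zero (j - i)
      rwa [map_sub, sub_eq_zero] at this
  · intro h
    have hi : xa i ∈ Subgroup.closure {xa i, xa j} := Subgroup.subset_closure (by simp)
    have hj : xa j ∈ Subgroup.closure {xa i, xa j} := Subgroup.subset_closure (by simp)
    refine eq_top_of_mem (i := j - i) ?_ hi h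
    -- The product of `xa i` and `xa j` is `a (n + j - i)`; the inverse square `a (-n)` removes the
    -- shift.
    have := Subgroup.mul_mem _ (Subgroup.inv_mem _ (Subgroup.pow_mem _ hi 2))
      (Subgroup.mul_mem _ hi hj)
    rw [xa_sq, xa_mul_xa] at this
    change a (-(n : ZMod (2 * n)) + ((n : ZMod (2 * n)) + j - i)) ∈ _ at this
    convert this using 2
    ring

theorem closure_a_a [NeZero n] (i j : ZMod (2 * n)) :
    Subgroup.closure {a i, a j} ≠ (⊤ : Subgroup (QuaternionGroup n)) := by
  intro h
  let A : Subgroup (QuaternionGroup n) :=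
    { carrier := Set.range a
      one_mem' := ⟨0, rfl⟩
      mul_mem' := by
        rintro _ _ ⟨s, rfl⟩ ⟨t, rfl⟩
        exact ⟨s + t, (a_mul_a s t).symm⟩
      inv_mem' := by
        rintro _ ⟨s, rfl⟩
        exact ⟨-s, rfl⟩ }
  have hA : Subgroup.closure {a i, a j} ≤ A := by
    rw [Subgroup.closure_le]
    rintro _ (rfl | rfl)
    exacts [⟨i, rfl⟩, ⟨j, rfl⟩]
  rw [h] at hA
  obtain ⟨t, ht⟩ := hA (Subgroup.mem_top (xa 0))
  cases ht

theorem generatingGraph_adj_a_a [NeZero n] (i j : ZMod (2 * n)) :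
    ¬ (generatingGraph (QuaternionGroup n)).Adj (a i) (a j) := fun h => closure_a_a i j h.2

theorem generatingGraph_adj_a_xa [NeZero n] (i j : ZMod (2 * n)) :
    (generatingGraph (QuaternionGroup n)).Adj (a i) (xa j) ↔ i.val.Coprime n :=
  ⟨fun h => (closure_a_xa i j).1 h.2, fun h => ⟨by simp, (closure_a_xa i j).2 h⟩⟩

theorem generatingGraph_adj_xa_xa [NeZero n] (hn : 2 ≤ n) (i j : ZMod (2 * n)) :
    (generatingGraph (QuaternionGroup n)).Adj (xa i) (xa j) ↔ (j - i).val.Coprime n := by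
  refine ⟨fun h => (closure_xa_xa i j).1 h.2, fun h => ⟨?_, (closure_xa_xa i j).2 h⟩⟩
  intro hij
  obtain rfl : i = j := by simpa using hij
  -- Here `0` would be coprime to `n`, forcing `n = 1`.
  simp at h
  lia

theorem val_one_coprime (hn : 2 ≤ n) : (1 : ZMod (2 * n)).val.Coprime n := by
  have : Fact (1 < 2 * n) := ⟨by lia⟩
  simp [ZMod.val_one]

theorem mem_support_a [NeZero n] (i : ZMod (2 * n)) :
    a i ∈ (generatingGraph (QuaternionGroup n)).support ↔ i.val.Coprime n := by
  rw [SimpleGraph.mem_support]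
  constructor
  · rintro ⟨j | j, h⟩
    · exact absurd h (generatingGraph_adj_a_a i j)
    · exact (generatingGraph_adj_a_xa i j).1 h
  · exact fun h => ⟨xa 0, (generatingGraph_adj_a_xa i 0).2 h⟩

theorem mem_support_xa [NeZero n] (hn : 2 ≤ n) (i : ZMod (2 * n)) :
    xa i ∈ (generatingGraph (QuaternionGroup n)).support :=
  (SimpleGraph.mem_support _).2
    ⟨a 1, ((generatingGraph_adj_a_xa 1 i).2 (val_one_coprime hn)).symm⟩

/-- The vertices of the reduced generating graph of `QuaternionGroup n`. -/
noncomputable def supportEquiv [NeZero n] (hn : 2 ≤ n) :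
    {i : ZMod (2 * n) // i.val.Coprime n} ⊕ ZMod (2 * n) ≃
      (generatingGraph (QuaternionGroup n)).support :=
  Equiv.ofBijective
    (Sum.elim (fun i => ⟨a i, (mem_support_a i.1).2 i.2⟩) fun i => ⟨xa i, mem_support_xa hn i⟩) <| by
    constructor
    · rintro (i | i) (j | j) h <;> simp_all [Subtype.ext_iff]
    · rintro ⟨i | i, hi⟩
      · exact ⟨.inl ⟨i, (mem_support_a i).1 hi⟩, rfl⟩
      · exact ⟨.inr i, rfl⟩

end QuaternionGroup

/-! ### Connectedness and the distance matrix -/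

theorem SimpleGraph.dist_eq_two {V : Type*} {G : SimpleGraph V} {u v w : V} (huv : u ≠ v)
    (h : ¬ G.Adj u v) (huw : G.Adj u w) (hwv : G.Adj w v) : G.dist u v = 2 := by
  have h1 : G.dist u v ≤ 2 := SimpleGraph.dist_le (.cons huw (.cons hwv .nil))
  have h2 : G.dist u v ≠ 1 := fun h' => h (SimpleGraph.dist_eq_one_iff_adj.1 h')
  have h3 : G.dist u v ≠ 0 := ((huw.reachable.trans hwv.reachable).pos_dist_of_ne huv).ne'
  lia

namespace QuaternionGroup

variable {n : ℕ} [NeZero n] (hn : 2 ≤ n)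

theorem adj_inl_inl (i j : {i : ZMod (2 * n) // i.val.Coprime n}) :
    ¬ (reducedGeneratingGraph (QuaternionGroup n)).Adj (supportEquiv hn (.inl i))
      (supportEquiv hn (.inl j)) := generatingGraph_adj_a_a i.1 j.1

theorem adj_inl_inr (i : {i : ZMod (2 * n) // i.val.Coprime n}) (j : ZMod (2 * n)) :
    (reducedGeneratingGraph (QuaternionGroup n)).Adj (supportEquiv hn (.inl i))
      (supportEquiv hn (.inr j)) := (generatingGraph_adj_a_xa i.1 j).2 i.2

theorem adj_inr_inr (i j : ZMod (2 * n)) :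
    (reducedGeneratingGraph (QuaternionGroup n)).Adj (supportEquiv hn (.inr i))
      (supportEquiv hn (.inr j)) ↔ (j - i).val.Coprime n := generatingGraph_adj_xa_xa hn i j

theorem connected_reducedGeneratingGraph (hn : 2 ≤ n) :
    (reducedGeneratingGraph (QuaternionGroup n)).Connected := by
  have hA : ∀ x, (reducedGeneratingGraph (QuaternionGroup n)).Reachable
      (supportEquiv hn (.inr 0)) (supportEquiv hn x) := by
    rintro (i | i)
    · exact (adj_inl_inr hn i 0).symm.reachable
    · exact (adj_inl_inr hn ⟨1, val_one_coprime hn⟩ 0).symm.reachable.trans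
        (adj_inl_inr hn ⟨1, val_one_coprime hn⟩ i).reachable
  have : Nonempty (generatingGraph (QuaternionGroup n)).support := ⟨supportEquiv hn (.inr 0)⟩
  refine ⟨fun u v => ?_⟩
  rw [← (supportEquiv hn).apply_symm_apply u, ← (supportEquiv hn).apply_symm_apply v]
  exact (hA _).symm.trans (hA _)

theorem distanceMatrix_submatrix :
    (distanceMatrix (reducedGeneratingGraph (QuaternionGroup n))).submatrix
        (supportEquiv hn) (supportEquiv hn) =
      Matrix.fromBlocks (Matrix.of fun i j => if i = j then 0 else 2)
        (Matrix.of fun _ _ => 1) (Matrix.of fun _ _ => 1)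
        (Matrix.of fun i j => (if i = j then 0 else 2) -
          if (j - i).val.Coprime n then 1 else 0) := by
  ext (i | i) (j | j)
  · simp only [distanceMatrix, Matrix.submatrix_apply, Matrix.of_apply, Matrix.fromBlocks_apply₁₁]
    split_ifs with hij
    · simp [hij]
    -- `xa 0` is a common neighbour; for two `xa`'s below, `a 1` is.
    · rw [SimpleGraph.dist_eq_two (by simpa using hij) (adj_inl_inl hn i j) (adj_inl_inr hn i 0)
        (adj_inl_inr hn j 0).symm]
      norm_num
  · simp [distanceMatrix, SimpleGraph.dist_eq_one_iff_adj.2 (adj_inl_inr hn i j)]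
  · simp [distanceMatrix, SimpleGraph.dist_eq_one_iff_adj.2 (adj_inl_inr hn j i).symm]
  · simp only [distanceMatrix, Matrix.submatrix_apply, Matrix.of_apply, Matrix.fromBlocks_apply₂₂]
    by_cases hij : i = j
    · subst hij
      have : n ≠ 1 := by lia
      simp [this]
    · by_cases hc : (j - i).val.Coprime n
      · rw [SimpleGraph.dist_eq_one_iff_adj.2 ((adj_inr_inr hn i j).2 hc)]
        rw [if_neg hij, if_pos hc]
        norm_num
      · rw [SimpleGraph.dist_eq_two (by simpa using hij) (fun h => hc ((adj_inr_inr hn i j).1 h))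
          (adj_inl_inr hn ⟨1, val_one_coprime hn⟩ i).symm
          (adj_inl_inr hn ⟨1, val_one_coprime hn⟩ j)]
        simp [hij, hc]

end QuaternionGroup

/-! ### Assembling the spectrum -/

theorem distanceSpectrum_eq_roots_charpoly_submatrix {V ι : Type*} [Finite V] [Fintype ι]
    [DecidableEq ι] (G : SimpleGraph V) (e : ι ≃ V) :
    distanceSpectrum G = ((distanceMatrix G).submatrix e e).charpoly.roots := by
  classical
  let _ : Fintype V := Fintype.ofFinite V
  rw [distanceSpectrum]
  congr 1
  rw [← Matrix.charpoly_reindex e.symm]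
  simp only [Matrix.reindex_apply, Equiv.symm_symm]

theorem ZMod.sum_val {N : ℕ} [NeZero N] {M : Type*} [AddCommMonoid M] (f : ℕ → M) :
    ∑ t : ZMod N, f t.val = ∑ j ∈ Finset.range N, f j := by
  obtain ⟨k, rfl⟩ := Nat.exists_eq_succ_of_ne_zero (NeZero.ne N)
  exact Fin.sum_univ_eq_sum_range f (k + 1)

theorem ZMod.isPrimitiveRoot_stdAddChar {N : ℕ} [NeZero N] (k : ZMod N) :
    IsPrimitiveRoot (ZMod.stdAddChar k : ℂ) (addOrderOf k) := by
  refine ⟨?_, fun l hl => ?_⟩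
  · rw [← AddChar.map_nsmul_eq_pow, addOrderOf_nsmul_eq_zero, AddChar.map_zero_eq_one]
  · rw [← AddChar.map_nsmul_eq_pow, ← AddChar.map_zero_eq_one (ZMod.stdAddChar (N := N))] at hl
    exact addOrderOf_dvd_of_nsmul_eq_zero (ZMod.injective_stdAddChar hl)

theorem sum_coprime_mul_stdAddChar {n : ℕ} [NeZero n] (k : ZMod (2 * n)) :
    ∑ t : ZMod (2 * n), (if t.val.Coprime n then (1 : ℂ) else 0) * ZMod.stdAddChar (t * k) =
      (coprimeSumValue n (addOrderOf k) : ℂ) := by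
  have hdvd : addOrderOf k ∣ 2 * n := by
    simpa [ZMod.card] using addOrderOf_dvd_card (x := k)
  rw [← sum_coprime_pow_eq_coprimeSumValue hdvd (ZMod.isPrimitiveRoot_stdAddChar k),
    Finset.sum_filter, ← ZMod.sum_val]
  refine Finset.sum_congr rfl fun t _ => ?_
  have : t * k = t.val • k := by rw [nsmul_eq_mul, ZMod.natCast_zmod_val]
  rw [this, AddChar.map_nsmul_eq_pow, ite_mul, one_mul, zero_mul]

theorem coprimeSumValue_one (n : ℕ) : coprimeSumValue n 1 = 2 * n.totient := by
  simp [coprimeSumValue]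

theorem card_coprime_zmod_two_mul (n : ℕ) [NeZero n] :
    Fintype.card {i : ZMod (2 * n) // i.val.Coprime n} = 2 * n.totient := by
  -- At the trivial character the sum just counts.
  have h := sum_coprime_mul_stdAddChar (0 : ZMod (2 * n))
  simp only [mul_zero, AddChar.map_zero_eq_one, mul_one, addOrderOf_zero, coprimeSumValue_one] at h
  rw [Fintype.card_subtype]
  rw [Finset.sum_boole] at h
  exact_mod_cast h

theorem QuaternionGroup.charpoly_distanceMatrix {n : ℕ} [NeZero n] (hn : 2 ≤ n) :
    ((distanceMatrix (reducedGeneratingGraph (QuaternionGroup n))).submatrix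
        (supportEquiv hn) (supportEquiv hn)).charpoly =
      ((X - C (4 * n.totient - 2 : ℝ)) * (X - C (4 * n - 2 - 2 * n.totient : ℝ)) -
        C (2 * n : ℝ) * C (2 * n.totient : ℝ)) * ((X - C (-2)) ^ (2 * n.totient - 1) *
          ∏ k ∈ (Finset.univ : Finset (ZMod (2 * n))).erase 0,
            (X - C (-2 - coprimeSumValue n (addOrderOf k)))) := by
  have hm : NeZero (2 * n.totient) := ⟨by
    have := Nat.totient_pos.2 (NeZero.pos n)
    lia⟩
  apply Polynomial.map_injective Complex.ofRealHom Complex.ofReal_injective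
  -- An arbitrary bijection suffices: the blocks meeting these vertices involve only `I` and `J`.
  let e : {i : ZMod (2 * n) // i.val.Coprime n} ≃ ZMod (2 * n.totient) :=
    Fintype.equivOfCardEq (by rw [card_coprime_zmod_two_mul, ZMod.card])
  rw [← Matrix.charpoly_map, ← Matrix.charpoly_reindex (e.sumCongr (Equiv.refl _)),
    distanceMatrix_submatrix]
  have h := charpoly_twoBlock (m := 2 * n.totient)
    (fun t : ZMod (2 * n) => if t.val.Coprime n then (1 : ℂ) else 0) _ sum_coprime_mul_stdAddChar
  convert h using 1
  · congr 1
    ext (i | i) (j | j)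
    · by_cases h : i = j <;> simp [h]
    · simp
    · simp
    · simp only [Matrix.reindex_apply, Matrix.submatrix_apply, Matrix.map_apply,
        Equiv.sumCongr_symm, Equiv.sumCongr_apply, Sum.map_inr, Equiv.refl_symm, Equiv.refl_apply,
        Matrix.fromBlocks_apply₂₂, Matrix.of_apply]
      split_ifs <;> simp
  · have h1 : (2 * ((2 * n.totient : ℕ) : ℂ) - 2) = ((4 * n.totient - 2 : ℝ) : ℂ) := by
      push_cast
      ring
    have h2 : (2 * ((2 * n : ℕ) : ℂ) - 2 - (coprimeSumValue n (addOrderOf (0 : ZMod (2 * n))) : ℂ)) =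
        ((4 * n - 2 - 2 * n.totient : ℝ) : ℂ) := by
      rw [addOrderOf_zero, coprimeSumValue_one]
      push_cast
      ring
    rw [h1, h2]
    simp only [Polynomial.map_mul, Polynomial.map_sub, Polynomial.map_X, Polynomial.map_C,
      Polynomial.map_pow, Polynomial.map_prod, Complex.ofRealHom_eq_coe]
    push_cast
    rfl

theorem Finset.map_val_comp_eq_sum_replicate {ι κ α : Type*} [DecidableEq κ] {s : Finset ι}
    {t : Finset κ} {f : ι → κ} (hf : ∀ x ∈ s, f x ∈ t) (g : κ → α) :
    s.val.map (fun x => g (f x)) =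
      ∑ d ∈ t, Multiset.replicate (s.filter fun x => f x = d).card (g d) := by
  have h1 : s.val.map (fun x => g (f x)) = ∑ x ∈ s, {g (f x)} := by
    rw [Finset.sum_eq_multiset_sum, ← Multiset.sum_map_singleton (s.val.map _), Multiset.map_map]
    rfl
  rw [h1, ← Finset.sum_fiberwise_of_maps_to hf]
  refine Finset.sum_congr rfl fun d _ => ?_
  rw [Finset.sum_congr rfl (g := fun _ => {g d})
    (by intro x hx; rw [(Finset.mem_filter.1 hx).2]), Finset.sum_const, Multiset.nsmul_singleton]

theorem ZMod.map_addOrderOf_eq_sum_replicate {N : ℕ} [NeZero N] {α : Type*} (g : ℕ → α) :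
    ((Finset.univ : Finset (ZMod N)).erase 0).val.map (fun k => g (addOrderOf k)) =
      ∑ d ∈ N.divisors.erase 1, Multiset.replicate d.totient (g d) := by
  rw [Finset.map_val_comp_eq_sum_replicate (t := N.divisors.erase 1)]
  · refine Finset.sum_congr rfl fun d hd => ?_
    have hd' := Finset.mem_erase.1 hd
    rw [← IsAddCyclic.card_addOrderOf_eq_totient (α := ZMod N) (d := d)
      (by rw [ZMod.card]; exact Nat.dvd_of_mem_divisors hd'.2)]
    congr 2
    ext k
    simp only [Finset.mem_filter, Finset.mem_erase, Finset.mem_univ, and_true, true_and,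
      and_iff_right_iff_imp]
    rintro rfl rfl
    simp at hd'
  · intro k hk
    have : addOrderOf k ∣ N := by simpa [ZMod.card] using addOrderOf_dvd_card (x := k)
    simpa [NeZero.ne N, this] using hk

theorem sum_replicate_const {κ α : Type*} (s : Finset κ) (f : κ → ℕ) (x : α) :
    ∑ d ∈ s, Multiset.replicate (f d) x = Multiset.replicate (∑ d ∈ s, f d) x :=
  (map_sum (Multiset.replicateAddMonoidHom x) f s).symm

open UniqueFactorizationMonoid in
-- Orders `d` not dividing the radical give `-2`; since `φ` sums to `N` over the divisors of `N`,
-- they account for `2 * n - radical n` eigenvalues.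
theorem sum_replicate_coprimeSumValue {n : ℕ} (hn : n ≠ 0) :
    ∑ d ∈ (2 * n).divisors.erase 1,
        Multiset.replicate d.totient (-2 - coprimeSumValue n d) =
      Multiset.replicate (2 * n - radical n) (-2 : ℝ) +
        ∑ d ∈ (radical n).divisors.erase 1, Multiset.replicate d.totient
          (-2 - 2 * (ArithmeticFunction.moebius d : ℝ) * ((n.totient : ℝ) / d.totient)) := by
  have hsub : (radical n).divisors ⊆ (2 * n).divisors :=
    Nat.divisors_subset_of_dvd (by lia) (radical_dvd_self.mul_left 2)
  have hrad : ∀ d ∈ (radical n).divisors, coprimeSumValue n d =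
      2 * (ArithmeticFunction.moebius d : ℝ) * ((n.totient : ℝ) / d.totient) := fun d hd =>
    if_pos ((Nat.dvd_of_mem_divisors hd).trans radical_dvd_self)
  have hcard : ∑ d ∈ (2 * n).divisors \ (radical n).divisors, d.totient = 2 * n - radical n := by
    have := Finset.sum_sdiff (f := Nat.totient) hsub
    rw [Nat.sum_totient, Nat.sum_totient] at this
    lia
  rw [← Finset.sum_sdiff (Finset.erase_subset_erase 1 hsub), ← hcard, ← sum_replicate_const]
  congr 1
  · have : (2 * n).divisors.erase 1 \ (radical n).divisors.erase 1 =
        (2 * n).divisors \ (radical n).divisors := by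
      ext d
      have : 1 ∈ (radical n).divisors := by simp [radical_ne_zero]
      grind
    rw [this]
    refine Finset.sum_congr rfl fun d hd => ?_
    rw [coprimeSumValue_of_not_dvd_radical hn, sub_zero]
    intro h
    exact (Finset.mem_sdiff.1 hd).2 (Nat.mem_divisors.2 ⟨h, radical_ne_zero⟩)
  · refine Finset.sum_congr rfl fun d hd => ?_
    rw [hrad d (Finset.mem_of_mem_erase hd)]

theorem mul_sub_eq_mul_of_sqrt (p q : ℝ) (h : 0 ≤ (3 * p - 2 * q) ^ 2 + 4 * q * p) :
    (X - C (4 * p - 2)) * (X - C (4 * q - 2 - 2 * p)) - C (2 * q) * C (2 * p) =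
      (X - C (p + 2 * (q - 1) + √((3 * p - 2 * q) ^ 2 + 4 * q * p))) *
        (X - C (p + 2 * (q - 1) - √((3 * p - 2 * q) ^ 2 + 4 * q * p))) := by
  set s := √((3 * p - 2 * q) ^ 2 + 4 * q * p)
  have hs : C s * C s = C ((3 * p - 2 * q) ^ 2 + 4 * q * p) := by
    rw [← C_mul, Real.mul_self_sqrt h]
  simp only [C_add, C_sub, C_mul, C_pow, map_ofNat, C_1] at hs ⊢
  linear_combination hs

/-- `QuaternionGroup n` is the dicyclic group of order `4 * n`, and
`UniqueFactorizationMonoid.radical n` is the product of the distinct primes dividing `n`.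
The instance `NeZero n`, implied by `hn`, provides finiteness of the group. -/
theorem mainTheorem3 (n : ℕ) [NeZero n] (hn : 2 ≤ n) :
    (reducedGeneratingGraph (QuaternionGroup n)).Connected ∧
    distanceSpectrum (reducedGeneratingGraph (QuaternionGroup n)) =
      Multiset.replicate
          (2 * (Nat.totient n + n) - UniqueFactorizationMonoid.radical n - 1) (-2 : ℝ)
        + ∑ d ∈ (UniqueFactorizationMonoid.radical n).divisors.erase 1,
            Multiset.replicate (Nat.totient d)
              (-2 - 2 * (ArithmeticFunction.moebius d : ℝ)
                * ((Nat.totient n : ℝ) / (Nat.totient d : ℝ)))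
        + {((Nat.totient n : ℝ) + 2 * ((n : ℝ) - 1))
              + √((3 * (Nat.totient n : ℝ) - 2 * (n : ℝ)) ^ 2
                  + 4 * (n : ℝ) * (Nat.totient n : ℝ)),
           ((Nat.totient n : ℝ) + 2 * ((n : ℝ) - 1))
              - √((3 * (Nat.totient n : ℝ) - 2 * (n : ℝ)) ^ 2
                  + 4 * (n : ℝ) * (Nat.totient n : ℝ))} := by
  refine ⟨QuaternionGroup.connected_reducedGeneratingGraph hn, ?_⟩
  rw [distanceSpectrum_eq_roots_charpoly_submatrix _ (QuaternionGroup.supportEquiv hn),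
    QuaternionGroup.charpoly_distanceMatrix hn, mul_sub_eq_mul_of_sqrt _ _ (by positivity)]
  -- The truncated subtractions are exact because `φ(n) ≥ 1` and `radical n ≤ n`.
  have hmul : 2 * (n.totient + n) - UniqueFactorizationMonoid.radical n - 1 =
      (2 * n.totient - 1) + (2 * n - UniqueFactorizationMonoid.radical n) := by
    have := Nat.totient_pos.2 (NeZero.pos n)
    have := Nat.radical_le_self_iff.2 (NeZero.ne n)
    lia
  rw [hmul, Multiset.replicate_add, add_assoc (Multiset.replicate _ _),
    ← sum_replicate_coprimeSumValue (NeZero.ne n),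
    ← ZMod.map_addOrderOf_eq_sum_replicate fun d => -2 - coprimeSumValue n d]
  set r₁ := (n.totient : ℝ) + 2 * ((n : ℝ) - 1) + √_
  set r₂ := (n.totient : ℝ) + 2 * ((n : ℝ) - 1) - √_
  rw [← Polynomial.roots_multiset_prod_X_sub_C (_ + _ + {r₁, r₂})]
  congr 1
  simp only [Multiset.map_add, Multiset.prod_add, Multiset.map_replicate, Multiset.prod_replicate,
    Multiset.map_map, Function.comp_def, Multiset.insert_eq_cons, Multiset.map_cons,
    Multiset.map_singleton, Multiset.prod_cons, Multiset.prod_singleton]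
  rw [Finset.prod]
  ring
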